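/- All graphs are finite, simple and undirected. For a graph $G$ let $A(G)$ be its adjacency matrix and $D(G)$ the diagonal matrix of its vertex degrees, and let $q(G)$ (the $Q$-index of $G$) be the largest eigenvalue of the signless Laplacian $Q(G)=D(G)+A(G)$. For $n\ge 2$ let $S_{n,2}=K_2\vee\overline{K}_{n-2}$ be the graph of order $n$ obtained by joining each vertex of the complete graph $K_2$ to each vertex of an independent set of order $n-2$. **Theorem.** Let $n\geq 6$ and let $G$ be a graph of order $n$. If $G$ contains no cycle of length $5$ as a (not necessarily induced) subgraph, then $$q(G)<q(S_{n,2}),$$ unless $G$ is isomorphic to $S_{n,2}$. -/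

import Mathlib

namespace QIndex

/-- The signless Laplacian `Q(G) = D(G) + A(G)`: degree matrix plus adjacency matrix. -/
def signlessLaplacian {V : Type*} [Fintype V] [DecidableEq V] (G : SimpleGraph V)
    [DecidableRel G.Adj] : Matrix V V ℝ :=
  G.degMatrix ℝ + G.adjMatrix ℝ

/-- The `Q`-index `q(G)`: the largest eigenvalue of the signless Laplacian of `G`.
See `isGreatest_qIndex` for the fact that the supremum is attained. -/
noncomputable def qIndex {V : Type*} [Fintype V] [DecidableEq V] (G : SimpleGraph V)
    [DecidableRel G.Adj] : ℝ :=
  sSup {μ : ℝ | Module.End.HasEigenvalue (Matrix.toLin' (signlessLaplacian G)) μ}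

theorem isGreatest_qIndex {V : Type*} [Fintype V] [DecidableEq V] [Nonempty V]
    (G : SimpleGraph V) [DecidableRel G.Adj] :
    IsGreatest {μ : ℝ | Module.End.HasEigenvalue (Matrix.toLin' (signlessLaplacian G)) μ}
      (qIndex G) := by
  have hH : (signlessLaplacian G).IsHermitian :=
    (G.isHermitian_degMatrix ℝ).add (G.isHermitian_adjMatrix ℝ)
  have hset : {μ : ℝ | Module.End.HasEigenvalue (Matrix.toLin' (signlessLaplacian G)) μ}
      = Set.range hH.eigenvalues := by
    rw [← hH.spectrum_real_eq_range_eigenvalues, ← Matrix.spectrum_toLin']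
    ext μ
    exact Module.End.hasEigenvalue_iff_mem_spectrum
  have hfin : (Set.range hH.eigenvalues).Finite := Set.finite_range _
  unfold qIndex
  rw [hset]
  exact ⟨(Set.range_nonempty _).csSup_mem hfin, fun _ hx => le_csSup hfin.bddAbove hx⟩

/-- The join `G ∨ H`: the disjoint union of `G` and `H` together with all edges between them. -/
def join {V W : Type*} (G : SimpleGraph V) (H : SimpleGraph W) : SimpleGraph (V ⊕ W) :=
  (G ⊕g H) ⊔ completeBipartiteGraph V W

/-- `S_{n,k}`, the join of the complete graph of order `k` and the edgeless graph of order
`n - k` (used for `k ≤ n`). -/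
def splitGraph (n k : ℕ) : SimpleGraph (Fin k ⊕ Fin (n - k)) :=
  join (⊤ : SimpleGraph (Fin k)) (⊥ : SimpleGraph (Fin (n - k)))

noncomputable instance (n k : ℕ) : DecidableRel (splitGraph n k).Adj :=
  Classical.decRel _

end QIndex

namespace QIndex

open Finset

/-! On vectors constant on the two parts, Q(S_{n,2}) has eigenvalues the roots of μ² - (n+2)μ + 4,
whence q(S_{n,2}) ≥ L := n + 2 - 4/(n+1). It suffices to find, for every other C₅-free G, a positive
x with Qx < Lx entrywise.

Call a vertex dominating if its degree is n - 1. Without dominating vertices, x is the degree vector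
and one must bound the sum of the degrees of the neighbours of u, which counts the 2-walks from u:
d(u) + 2e(N(u)) plus the edges from N(u) to vertices outside N[u]. As G is C₅-free, N(u) induces no
path on four vertices, so its components are stars and triangles, which bounds e(N(u))
(`sum_codegree_add_le`); a vertex outside N[u] with at least two neighbours in N(u) either sees only
isolated vertices of N(u) or exactly the two ends of a single-edge component (`codegree_le_max`).
`sq_degree_add_sum_lt` balances these counts.

With one dominating vertex the same local structure holds in all of G - u, and a modified degree
vector works. Two dominating vertices force G = S_{n,2}. -/

theorem signlessLaplacian_mulVec {V : Type*} [Fintype V] [DecidableEq V] (G : SimpleGraph V)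
    [DecidableRel G.Adj] (x : V → ℝ) (v : V) :
    (signlessLaplacian G).mulVec x v = G.degree v * x v + ∑ w ∈ G.neighborFinset v, x w := by
  simp [signlessLaplacian, Matrix.add_mulVec, SimpleGraph.degMatrix, Matrix.mulVec_diagonal]

/-- A positive vector `x` with `Q x < L x` entrywise bounds the `Q`-index. -/
theorem qIndex_lt_of_test_vector {V : Type*} [Fintype V] [DecidableEq V] [Nonempty V]
    (G : SimpleGraph V) [DecidableRel G.Adj] (x : V → ℝ) (L : ℝ) (hx : ∀ v, 0 < x v)
    (h : ∀ v, G.degree v * x v + ∑ w ∈ G.neighborFinset v, x w < L * x v) :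
    qIndex G < L := by
  obtain ⟨y, hy⟩ := (isGreatest_qIndex G).1.exists_hasEigenvector
  have hy0 : y ≠ 0 := hy.2
  have heq : ∀ v, G.degree v * y v + ∑ w ∈ G.neighborFinset v, y w = qIndex G * y v := by
    intro v
    have h1 := congrFun hy.apply_eq_smul v
    rw [Matrix.toLin'_apply, signlessLaplacian_mulVec] at h1
    simpa using h1
  -- Collatz–Wielandt: the eigenvalue equation is read at a vertex maximising |y|/x.
  obtain ⟨v, hv⟩ := Finite.exists_max (fun v => |y v| / x v)
  have hb : ∀ w, |y w| ≤ |y v| / x v * x w := fun w => (div_le_iff₀ (hx w)).1 (hv w)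
  obtain ⟨w₀, hw₀⟩ := Function.ne_iff.1 hy0
  have ht : 0 < |y v| / x v := lt_of_lt_of_le (div_pos (abs_pos.2 hw₀) (hx w₀)) (hv w₀)
  have hyv : 0 < |y v| := by
    have := mul_pos ht (hx v)
    rwa [div_mul_cancel₀ _ (hx v).ne'] at this
  have key : qIndex G * |y v| < L * |y v| := by
    calc qIndex G * |y v| ≤ |qIndex G * y v| := by
          rw [abs_mul]; gcongr; exact le_abs_self _
      _ = |G.degree v * y v + ∑ w ∈ G.neighborFinset v, y w| := by rw [heq]
      _ ≤ |G.degree v * y v| + |∑ w ∈ G.neighborFinset v, y w| := abs_add_le _ _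
      _ ≤ G.degree v * |y v| + ∑ w ∈ G.neighborFinset v, |y w| := by
          rw [abs_mul, Nat.abs_cast]; gcongr; exact abs_sum_le_sum_abs _ _
      _ ≤ G.degree v * (|y v| / x v * x v) + ∑ w ∈ G.neighborFinset v, |y v| / x v * x w := by
          gcongr <;> exact hb _
      _ = |y v| / x v * (G.degree v * x v + ∑ w ∈ G.neighborFinset v, x w) := by
          rw [← mul_sum]; ring
      _ < |y v| / x v * (L * x v) := by gcongr; exact h v
      _ = L * |y v| := by field_simp [(hx v).ne']
  exact lt_of_mul_lt_mul_right key hyv.le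

/-! ### The extremal graph -/

theorem splitGraph_adj_inl_inl {n k : ℕ} (a b : Fin k) :
    (splitGraph n k).Adj (.inl a) (.inl b) ↔ a ≠ b := by
  simp [splitGraph, join]

theorem splitGraph_adj_inl_inr {n k : ℕ} (a : Fin k) (b : Fin (n - k)) :
    (splitGraph n k).Adj (.inl a) (.inr b) := by
  simp [splitGraph, join]

theorem splitGraph_adj_inr_inl {n k : ℕ} (a : Fin k) (b : Fin (n - k)) :
    (splitGraph n k).Adj (.inr b) (.inl a) := by
  simp [splitGraph, join]

theorem splitGraph_not_adj_inr_inr {n k : ℕ} (a b : Fin (n - k)) :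
    ¬ (splitGraph n k).Adj (.inr a) (.inr b) := by
  simp [splitGraph, join]

theorem le_qIndex_splitGraph_two (n : ℕ) (hn : 6 ≤ n) :
    (n : ℝ) + 2 - 4 / (n + 1) ≤ qIndex (splitGraph n 2) := by
  have hn' : (6 : ℝ) ≤ n := by exact_mod_cast hn
  set s := √(((n : ℝ) + 2) ^ 2 - 16) with hs
  have hs2 : s ^ 2 = ((n : ℝ) + 2) ^ 2 - 16 := Real.sq_sqrt (by nlinarith)
  have hs0 : 0 ≤ s := Real.sqrt_nonneg _
  -- The larger eigenvalue of the quotient matrix with rows (n, n-2) and (2, 2).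
  set μ := ((n : ℝ) + 2 + s) / 2 with hμ
  have hq : μ ^ 2 - (n + 2) * μ + 4 = 0 := by rw [hμ]; nlinarith
  have hsn : (n : ℝ) < s := by nlinarith
  have hμn : (n : ℝ) + 1 ≤ μ := by rw [hμ]; linarith
  have hle : (n : ℝ) + 2 - 4 / (n + 1) ≤ μ := by
    have h1 : μ = n + 2 - 4 / μ := by
      have : μ ≠ 0 := by linarith
      field_simp; linarith
    have h2 : 4 / μ ≤ 4 / ((n : ℝ) + 1) := by gcongr
    linarith
  have : Nonempty (Fin 2 ⊕ Fin (n - 2)) := ⟨.inl 0⟩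
  refine hle.trans ((isGreatest_qIndex (splitGraph n 2)).2 ?_)
  let y : Fin 2 ⊕ Fin (n - 2) → ℝ := Sum.elim (fun _ => μ - 2) (fun _ => 2)
  refine Module.End.hasEigenvalue_of_hasEigenvector (x := y) ⟨?_, ?_⟩
  · rw [Module.End.mem_eigenspace_iff]
    have hc : ((n - 2 : ℕ) : ℝ) = n - 2 := by push_cast [Nat.cast_sub (show 2 ≤ n by omega)]; rfl
    ext v
    rw [Matrix.toLin'_apply, signlessLaplacian_mulVec]
    have hdeg : ((splitGraph n 2).degree v : ℝ)
        = ∑ w, if (splitGraph n 2).Adj v w then (1 : ℝ) else 0 := by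
      rw [← SimpleGraph.card_neighborFinset_eq_degree, SimpleGraph.neighborFinset_eq_filter]
      simp
    rw [hdeg, SimpleGraph.neighborFinset_eq_filter, sum_filter, Fintype.sum_sum_type,
      Fintype.sum_sum_type]
    rcases v with a | b
    · fin_cases a <;>
        simp [splitGraph_adj_inl_inl, splitGraph_adj_inl_inr, y, hc] <;>
        linarith
    · simp [splitGraph_adj_inr_inl, splitGraph_not_adj_inr_inr, y]
      linarith
  · intro h
    have := congrFun h (.inl 0)
    simp [y] at this
    linarith

theorem nonempty_iso_splitGraph {V : Type*} [Fintype V] [DecidableEq V] {n : ℕ}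
    (G : SimpleGraph V) (hcard : Fintype.card V = n) {u v : V} (huv : u ≠ v)
    (hadj : ∀ x y, G.Adj x y ↔ x ≠ y ∧ ((x = u ∨ x = v) ∨ (y = u ∨ y = v))) :
    Nonempty (G ≃g splitGraph n 2) := by
  have h2 : Fintype.card {x // x = u ∨ x = v} = 2 := by
    rw [Fintype.card_subtype, show univ.filter (fun x => x = u ∨ x = v) = {u, v} by ext; simp]
    exact card_pair huv
  have h3 : Fintype.card {x // ¬ (x = u ∨ x = v)} = n - 2 := by
    rw [Fintype.card_subtype_compl, h2, hcard]
  let e₁ := Fintype.equivFinOfCardEq h2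
  let e₂ := Fintype.equivFinOfCardEq h3
  let e : Fin 2 ⊕ Fin (n - 2) ≃ V :=
    (Equiv.sumCongr e₁.symm e₂.symm).trans (Equiv.sumCompl (fun x => x = u ∨ x = v))
  have hl : ∀ a, e (.inl a) = u ∨ e (.inl a) = v := fun a => (e₁.symm a).2
  have hr : ∀ a, ¬ (e (.inr a) = u ∨ e (.inr a) = v) := fun a => (e₂.symm a).2
  refine ⟨(RelIso.mk e ?_ : splitGraph n 2 ≃g G).symm⟩
  rintro (a | a) (b | b)
  · rw [hadj, splitGraph_adj_inl_inl]
    simp [hl]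
  · rw [hadj]
    simp [hl, splitGraph_adj_inl_inr]
  · rw [hadj]
    simp [hl, splitGraph_adj_inr_inl]
  · rw [hadj]
    simp only [hr, splitGraph_not_adj_inr_inr, or_self, and_false]

/-! ### Local structure of C₅-free graphs -/

theorem not_cycle_five {V : Type*} {G : SimpleGraph V}
    (hC5 : (SimpleGraph.cycleGraph 5).Free G) {a b c d e : V}
    (hab : G.Adj a b) (hbc : G.Adj b c) (hcd : G.Adj c d) (hde : G.Adj d e) (hea : G.Adj e a)
    (hac : a ≠ c) (had : a ≠ d) (hbd : b ≠ d) (hbe : b ≠ e) (hce : c ≠ e) : False := by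
  apply hC5
  refine ⟨⟨⟨![a, b, c, d, e], ?_⟩, ?_⟩⟩
  · intro i j hij
    have h : ∀ i j : Fin 5, (SimpleGraph.cycleGraph 5).Adj i j →
      (i = j + 1 ∨ j = i + 1) := by decide
    rcases h i j hij with rfl | rfl
    · fin_cases j <;>
        first | exact hab.symm | exact hbc.symm | exact hcd.symm | exact hde.symm | exact hea.symm
    · fin_cases i <;> first | exact hab | exact hbc | exact hcd | exact hde | exact hea
  · intro i j hij
    have := hab.ne; have := hbc.ne; have := hcd.ne; have := hde.ne; have := hea.ne
    fin_cases i <;> fin_cases j <;> first | rfl | (exfalso; simp at hij; grind)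

variable {V : Type*} [Fintype V] [DecidableEq V] {G : SimpleGraph V} [DecidableRel G.Adj]

/-- The number of common neighbours of `u` and `v`. -/
def codegree (G : SimpleGraph V) [DecidableRel G.Adj] (u v : V) : ℕ :=
  #(G.neighborFinset u ∩ G.neighborFinset v)

/-- Both sides count the walks of length two from u. -/
theorem sum_degree_neighborFinset (u : V) :
    ∑ v ∈ G.neighborFinset u, G.degree v = ∑ w, codegree G u w := by
  simp_rw [← SimpleGraph.card_neighborFinset_eq_degree, codegree, card_eq_sum_ones]
  apply sum_comm'
  intro x y
  simp [G.adj_comm x y]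

/-- Inside the neighbourhood of a vertex of a `C₅`-free graph every edge has an end of degree one
or lies in a triangle component. -/
theorem codegree_of_adj (hC5 : (SimpleGraph.cycleGraph 5).Free G) {u v w : V}
    (hv : G.Adj u v) (hw : G.Adj u w) (hvw : G.Adj v w) :
    codegree G u v = 1 ∨ codegree G u w = 1 ∨ (codegree G u v = 2 ∧ codegree G u w = 2) := by
  by_contra! hcon
  obtain ⟨h1, h2, h3⟩ := hcon
  have mv : w ∈ G.neighborFinset u ∩ G.neighborFinset v := by simp [hw, hvw]
  have mw : v ∈ G.neighborFinset u ∩ G.neighborFinset w := by simp [hv, hvw.symm]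
  have pv : ((G.neighborFinset u ∩ G.neighborFinset v).erase w).Nonempty := by
    rw [← card_pos, card_erase_of_mem mv]
    have := card_pos.2 ⟨w, mv⟩
    unfold codegree at h1; omega
  have pw : ((G.neighborFinset u ∩ G.neighborFinset w).erase v).Nonempty := by
    rw [← card_pos, card_erase_of_mem mw]
    have := card_pos.2 ⟨v, mw⟩
    unfold codegree at h2; omega
  -- Otherwise u x v w y is a 5-cycle.
  have key : ∀ x ∈ (G.neighborFinset u ∩ G.neighborFinset v).erase w,
      ∀ y ∈ (G.neighborFinset u ∩ G.neighborFinset w).erase v, x = y := by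
    intro x hx y hy
    simp only [mem_erase, mem_inter, SimpleGraph.mem_neighborFinset] at hx hy
    by_contra hxy
    exact not_cycle_five hC5 hx.2.1 hx.2.2.symm hvw hy.2.2 hy.2.1.symm hv.ne hw.ne hx.1 hxy
      hy.1.symm
  obtain ⟨x, hx⟩ := pv
  obtain ⟨y, hy⟩ := pw
  have e1 : (G.neighborFinset u ∩ G.neighborFinset v).erase w = {y} :=
    eq_singleton_iff_unique_mem.2 ⟨key x hx y hy ▸ hx, fun z hz => key z hz y hy⟩
  have e2 : (G.neighborFinset u ∩ G.neighborFinset w).erase v = {x} :=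
    eq_singleton_iff_unique_mem.2 ⟨key x hx y hy ▸ hy, fun z hz => (key x hx z hz).symm⟩
  apply h3
  · have := congrArg card e1
    rw [card_erase_of_mem mv, card_singleton] at this
    unfold codegree; omega
  · have := congrArg card e2
    rw [card_erase_of_mem mw, card_singleton] at this
    unfold codegree; omega

/-- Each edge `vw` inside `N(u)` contributes `1 / f v + 1 / f w ≥ 1`, with `f` the codegree to `u`,
to the number of non-isolated vertices, and a single-edge component contributes `2`. -/
theorem sum_codegree_add_le (hC5 : (SimpleGraph.cycleGraph 5).Free G) (u : V) :
    ∑ v ∈ G.neighborFinset u, codegree G u v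
        + #{v ∈ G.neighborFinset u | ∃ w ∈ G.neighborFinset u, G.Adj v w ∧
            codegree G u v = 1 ∧ codegree G u w = 1}
      ≤ 2 * #{v ∈ G.neighborFinset u | codegree G u v ≠ 0} := by
  set A := G.neighborFinset u
  set f : V → ℝ := fun v => codegree G u v with hf
  have hE : ∀ v ∈ A, ∀ w ∈ A ∩ G.neighborFinset v, 0 ≤ 1 / f v + 1 / f w - 1 := by
    intro v hv w hw
    simp only [A, mem_inter, SimpleGraph.mem_neighborFinset] at hv hw
    rcases codegree_of_adj hC5 hv hw.1 hw.2 with h | h | ⟨h, h'⟩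
    · simp only [hf, h]; simp
    · simp only [hf, h]; simp
    · simp only [hf, h, h']; norm_num
  have h1 : ∑ v ∈ A, ∑ w ∈ A ∩ G.neighborFinset v, 1 / f v
      = #{v ∈ A | codegree G u v ≠ 0} := by
    rw [card_filter, Nat.cast_sum]
    refine sum_congr rfl fun v _ => ?_
    rw [sum_const, nsmul_eq_mul]
    change (codegree G u v : ℝ) * (1 / (codegree G u v : ℝ)) = _
    split_ifs with h
    · have : (codegree G u v : ℝ) ≠ 0 := by exact_mod_cast h
      field_simp; simp
    · push Not at h; simp [h]
  have h2 : ∑ v ∈ A, ∑ w ∈ A ∩ G.neighborFinset v, 1 / f w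
      = #{v ∈ A | codegree G u v ≠ 0} := by
    rw [← h1]
    apply sum_comm'
    intro x y
    simp only [mem_inter, SimpleGraph.mem_neighborFinset, G.adj_comm x y]
    tauto
  have h3 : ∑ v ∈ A, ∑ w ∈ A ∩ G.neighborFinset v, (1 : ℝ) = ∑ v ∈ A, f v := by
    refine sum_congr rfl fun v _ => ?_
    simp [hf, codegree, A]
  have h4 : (#{v ∈ A | ∃ w ∈ A, G.Adj v w ∧ codegree G u v = 1 ∧ codegree G u w = 1} : ℝ)
      ≤ ∑ v ∈ A, ∑ w ∈ A ∩ G.neighborFinset v, (1 / f v + 1 / f w - 1) := by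
    rw [card_filter, Nat.cast_sum]
    refine sum_le_sum fun v hv => ?_
    split_ifs with h
    · obtain ⟨w, hw, hvw, e1, e2⟩ := h
      refine le_trans ?_ (single_le_sum (hE v hv) (by simp [hw, hvw] : w ∈ _))
      simp [hf, e1, e2]
    · simpa using sum_nonneg (hE v hv)
  simp only [sum_sub_distrib, sum_add_distrib] at h4
  rw [h1, h2, h3] at h4
  have : (∑ v ∈ A, codegree G u v : ℝ)
      + #{v ∈ A | ∃ w ∈ A, G.Adj v w ∧ codegree G u v = 1 ∧ codegree G u w = 1}
      ≤ 2 * #{v ∈ A | codegree G u v ≠ 0} := by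
    simp only [hf] at h4; linarith
  exact_mod_cast this

/-- Let a ≠ b be common neighbours of u and w, and let c be a neighbour of a in N(u). Then u b w a c
is a 5-cycle unless c = b. So either all common neighbours are isolated in N(u), or there are just
two and they form a component of N(u). -/
theorem codegree_le_max (hC5 : (SimpleGraph.cycleGraph 5).Free G) {u w : V}
    (hw : ¬ G.Adj u w) (hne : w ≠ u) (h2 : 2 ≤ codegree G u w) :
    codegree G u w ≤ #{v ∈ G.neighborFinset u | codegree G u v = 0} ∨
    (codegree G u w = 2 ∧ 2 ≤ #{v ∈ G.neighborFinset u | ∃ w ∈ G.neighborFinset u, G.Adj v w ∧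
            codegree G u v = 1 ∧ codegree G u w = 1}) := by
  have key : ∀ a ∈ G.neighborFinset u ∩ G.neighborFinset w,
      ∀ b ∈ G.neighborFinset u ∩ G.neighborFinset w, a ≠ b →
      ∀ c ∈ G.neighborFinset u ∩ G.neighborFinset a, c = b := by
    intro a ha b hb hab c hc
    simp only [mem_inter, SimpleGraph.mem_neighborFinset] at ha hb hc
    by_contra hcb
    exact not_cycle_five hC5 hb.1 hb.2.symm ha.2 hc.2 hc.1.symm hne.symm ha.1.ne hab.symm
      (Ne.symm hcb) (by rintro rfl; exact hw hc.1)
  by_cases hz : ∃ a ∈ G.neighborFinset u ∩ G.neighborFinset w, codegree G u a ≠ 0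
  · right
    obtain ⟨a, ha, hca⟩ := hz
    obtain ⟨c, hc⟩ := card_pos.1 (Nat.pos_of_ne_zero hca)
    have huniq : (G.neighborFinset u ∩ G.neighborFinset w).erase a ⊆ {c} := by
      intro b hb
      rw [mem_erase] at hb
      simp [key a ha b hb.2 hb.1.symm c hc]
    have hcard := card_le_card huniq
    rw [card_erase_of_mem ha, card_singleton] at hcard
    have hcard2 : codegree G u w = 2 := by unfold codegree at h2 ⊢; omega
    obtain ⟨b, hb⟩ : ((G.neighborFinset u ∩ G.neighborFinset w).erase a).Nonempty := by
      rw [← card_pos, card_erase_of_mem ha]; unfold codegree at h2; omega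
    rw [mem_erase] at hb
    have hcb := key a ha b hb.2 hb.1.symm c hc
    subst hcb
    have ea : codegree G u a = 1 :=
      card_eq_one.2 ⟨c, eq_singleton_iff_unique_mem.2 ⟨hc, key a ha c hb.2 hb.1.symm⟩⟩
    have ha' := mem_inter.1 ha
    have hb' := mem_inter.1 hb.2
    have hc' := mem_inter.1 hc
    have hac : G.Adj a c := by simpa using hc'.2
    have ec : codegree G u c = 1 :=
      card_eq_one.2 ⟨a, eq_singleton_iff_unique_mem.2
        ⟨by simpa [hac.symm] using ha'.1, key c hb.2 a ha hb.1⟩⟩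
    refine ⟨hcard2, ?_⟩
    rw [← card_pair hac.ne]
    apply card_le_card
    intro x hx
    rw [mem_insert, mem_singleton] at hx
    rw [mem_filter]
    rcases hx with rfl | rfl
    · exact ⟨ha'.1, c, hb'.1, hac, ea, ec⟩
    · exact ⟨hb'.1, a, ha'.1, hac.symm, ec, ea⟩
  · left
    push Not at hz
    apply card_le_card
    intro a ha
    exact mem_filter.2 ⟨(mem_inter.1 ha).1, hz a ha⟩

/-! ### The degree vector at non-dominating vertices -/

theorem codegree_self (u : V) : codegree G u u = G.degree u := by
  simp [codegree]

theorem codegree_lt_degree {u v : V} (h : G.Adj u v) : codegree G u v < G.degree u := by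
  rw [← SimpleGraph.card_neighborFinset_eq_degree]
  refine card_lt_card ((ssubset_iff_of_subset inter_subset_left).2 ⟨v, ?_, ?_⟩) <;> simp [h]

theorem sum_codegree_split (u : V) :
    ∑ w, codegree G u w = G.degree u + ∑ v ∈ G.neighborFinset u, codegree G u v
      + ∑ w ∈ (insert u (G.neighborFinset u))ᶜ, codegree G u w := by
  rw [← sum_add_sum_compl (insert u (G.neighborFinset u)), sum_insert (by simp), codegree_self]

theorem sq_degree_add_sum_lt (hC5 : (SimpleGraph.cycleGraph 5).Free G) {n : ℕ} (hn : 6 ≤ n)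
    (hcard : Fintype.card V = n) {L : ℝ} (hL : (n : ℝ) + 10 / 7 ≤ L) {u : V}
    (hd1 : 1 ≤ G.degree u) (hd2 : G.degree u + 2 ≤ n) :
    (G.degree u : ℝ) * G.degree u + ∑ v ∈ G.neighborFinset u, (G.degree v : ℝ)
      < L * G.degree u := by
  have hsum : ∑ v ∈ G.neighborFinset u, (G.degree v : ℝ)
      = G.degree u + (∑ v ∈ G.neighborFinset u, codegree G u v : ℕ)
      + (∑ w ∈ (insert u (G.neighborFinset u))ᶜ, codegree G u w : ℕ) := by
    rw [← Nat.cast_sum, sum_degree_neighborFinset, sum_codegree_split]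
    push_cast; ring
  have hF := sum_codegree_add_le hC5 u
  have hF1 : ∑ v ∈ G.neighborFinset u, codegree G u v ≤ G.degree u * (G.degree u - 1) := by
    rw [← SimpleGraph.card_neighborFinset_eq_degree, ← smul_eq_mul]
    refine sum_le_card_nsmul _ _ _ fun v hv => ?_
    have := codegree_lt_degree ((SimpleGraph.mem_neighborFinset _ _ _).1 hv)
    rw [SimpleGraph.card_neighborFinset_eq_degree]; omega
  have hB : #(insert u (G.neighborFinset u))ᶜ + G.degree u + 1 = n := by
    have := card_compl_add_card (insert u (G.neighborFinset u))
    rw [card_insert_of_notMem (by simp), SimpleGraph.card_neighborFinset_eq_degree, hcard] at this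
    omega
  have hi : #{v ∈ G.neighborFinset u | codegree G u v = 0}
      + #{v ∈ G.neighborFinset u | codegree G u v ≠ 0} = G.degree u := by
    rw [← SimpleGraph.card_neighborFinset_eq_degree]
    exact card_filter_add_card_filter_not _
  have hc : ∀ w ∈ (insert u (G.neighborFinset u))ᶜ, codegree G u w ≤ 1 ∨
      codegree G u w ≤ #{v ∈ G.neighborFinset u | codegree G u v = 0} ∨
      (codegree G u w = 2 ∧ 2 ≤ #{v ∈ G.neighborFinset u | ∃ w ∈ G.neighborFinset u, G.Adj v w ∧
            codegree G u v = 1 ∧ codegree G u w = 1}) := by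
    intro w hw
    simp only [mem_compl, mem_insert, SimpleGraph.mem_neighborFinset, not_or] at hw
    rcases Nat.lt_or_ge (codegree G u w) 2 with h | h
    · left; omega
    · right; exact codegree_le_max hC5 hw.2 hw.1 h
  have hcd : ∀ w, codegree G u w ≤ G.degree u := fun w => by
    rw [← SimpleGraph.card_neighborFinset_eq_degree]
    exact card_le_card inter_subset_left
  have hE : ∀ m, (∀ w ∈ (insert u (G.neighborFinset u))ᶜ, codegree G u w ≤ m) →
      ∑ w ∈ (insert u (G.neighborFinset u))ᶜ, codegree G u w
        ≤ #(insert u (G.neighborFinset u))ᶜ * m := by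
    intro m hm
    rw [← smul_eq_mul]
    exact sum_le_card_nsmul _ _ _ hm
  rw [hsum]
  -- What remains is d² + d + F + E < Ld, where F = 2e(N(u)), E counts the edges from N(u) to the b
  -- vertices outside N[u], i and j count the isolated and non-isolated vertices of N(u), and K
  -- those in single-edge components.
  generalize ∑ v ∈ G.neighborFinset u, codegree G u v = F at *
  generalize ∑ w ∈ (insert u (G.neighborFinset u))ᶜ, codegree G u w = E at *
  generalize (insert u (G.neighborFinset u))ᶜ = B at *
  generalize #{v ∈ G.neighborFinset u | codegree G u v = 0} = i at *
  generalize #{v ∈ G.neighborFinset u | codegree G u v ≠ 0} = j at *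
  generalize #{v ∈ G.neighborFinset u | ∃ w ∈ G.neighborFinset u, G.Adj v w ∧
            codegree G u v = 1 ∧ codegree G u w = 1} = K at *
  generalize G.degree u = d at *
  generalize #B = b at *
  have hn' : (6 : ℝ) ≤ n := by exact_mod_cast hn
  have hd1' : (1 : ℝ) ≤ d := by exact_mod_cast hd1
  have hd2' : (d : ℝ) + 2 ≤ n := by exact_mod_cast hd2
  have hB' : (b : ℝ) = n - 1 - d := by
    have : (b : ℝ) + d + 1 = n := by exact_mod_cast hB
    linarith
  have hLd : ((n : ℝ) + 10 / 7) * d ≤ L * d := by gcongr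
  by_cases h3 : 3 ≤ i
  · have h1 : (E : ℝ) ≤ b * i := by
      exact_mod_cast hE i fun w hw => by rcases hc w hw with h | h | h <;> omega
    have h2 : (F : ℝ) + 2 * i ≤ 2 * d := by
      have : F + 2 * i ≤ 2 * d := by omega
      exact_mod_cast this
    have h4 : (i : ℝ) ≤ d := by
      have : i ≤ d := by omega
      exact_mod_cast this
    have h5 : (0 : ℝ) ≤ i := by positivity
    rw [hB'] at h1
    -- The left side is at most d² + 3d + (b-2)i, so the sign of b - 2 decides whether i ≤ d or i ≥
    -- 0 is the useful bound.
    rcases Nat.lt_or_ge b 2 with hb | hb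
    · have : (n : ℝ) ≤ d + 2 := by
        have : n ≤ d + 2 := by omega
        exact_mod_cast this
      nlinarith
    · have : (d : ℝ) + 3 ≤ n := by
        have : d + 3 ≤ n := by omega
        exact_mod_cast this
      nlinarith
  by_cases h1 : ∀ w ∈ B, codegree G u w ≤ 1
  · have hE1 : (E : ℝ) ≤ b := by
      have := hE 1 h1
      rw [mul_one] at this
      exact_mod_cast this
    rcases Nat.lt_or_ge d 2 with hd | hd
    · obtain rfl : d = 1 := by omega
      have hF0 : (F : ℝ) ≤ 0 := by exact_mod_cast hF1
      push_cast at *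
      linarith
    · have hF2 : (F : ℝ) ≤ 2 * d := by
        have : F ≤ 2 * d := by omega
        exact_mod_cast this
      have hd' : (2 : ℝ) ≤ d := by exact_mod_cast hd
      -- The slack nd + 10d/7 - (d² + 2d + n - 1) is concave in d and positive at d = 2 and d = n -
      -- 2.
      nlinarith
  · push Not at h1
    obtain ⟨w, hw, hw1⟩ := h1
    have hd : 2 ≤ d := (Nat.succ_le_of_lt hw1).trans (hcd w)
    have hE2 : (E : ℝ) ≤ b * 2 := by
      exact_mod_cast hE 2 fun w hw => by rcases hc w hw with h | h | h <;> omega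
    -- A codegree of at least 2 requires two isolated vertices or a single-edge component in N(u),
    -- and either one lowers the bound on F.
    have hF2 : (F : ℝ) + 2 ≤ 2 * d := by
      have : F + 2 ≤ 2 * d := by rcases hc w hw with h | h | h <;> omega
      exact_mod_cast this
    have hd' : (2 : ℝ) ≤ d := by exact_mod_cast hd
    -- The slack is at least (d-2)(n-d-2) + 3d/7.
    nlinarith

theorem qIndex_lt_of_degree_le (hC5 : (SimpleGraph.cycleGraph 5).Free G) {n : ℕ} (hn : 6 ≤ n)
    (hcard : Fintype.card V = n) {L : ℝ} (hL : (n : ℝ) + 10 / 7 ≤ L)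
    (hd : ∀ v, G.degree v + 2 ≤ n) : qIndex G < L := by
  have : Nonempty V := Fintype.card_pos_iff.1 (by omega)
  -- The value 1 at isolated vertices only keeps the vector positive: they are nobody's neighbours.
  refine qIndex_lt_of_test_vector G (fun v => if G.degree v = 0 then 1 else G.degree v) L ?_ ?_
  · intro v
    split_ifs with h
    · exact one_pos
    · exact_mod_cast Nat.pos_of_ne_zero h
  · intro v
    have hs : ∑ w ∈ G.neighborFinset v, (if G.degree w = 0 then (1 : ℝ) else G.degree w)
        = ∑ w ∈ G.neighborFinset v, (G.degree w : ℝ) := by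
      refine sum_congr rfl fun w hw => if_neg ?_
      rw [SimpleGraph.mem_neighborFinset] at hw
      exact ((G.degree_pos_iff_exists_adj w).2 ⟨v, hw.symm⟩).ne'
    simp only [hs]
    split_ifs with h
    · have he : G.neighborFinset v = ∅ := by
        rwa [← card_eq_zero, SimpleGraph.card_neighborFinset_eq_degree]
      rw [he, h]
      have : (0 : ℝ) ≤ n := by positivity
      norm_num
      linarith
    · exact sq_degree_add_sum_lt hC5 hn hcard hL (Nat.pos_of_ne_zero h) (hd v)

/-! ### Dominating vertices -/

theorem adj_of_degree {u v : V} (h : G.degree u + 1 = Fintype.card V) (huv : v ≠ u) :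
    G.Adj u v := by
  have h1 : insert u (G.neighborFinset u) = univ := by
    rw [← card_eq_iff_eq_univ, card_insert_of_notMem (by simp),
      SimpleGraph.card_neighborFinset_eq_degree, h]
  have h2 := mem_univ v
  rw [← h1] at h2
  simpa [huv] using h2

theorem degree_eq_codegree_add_one {u v : V} (h : G.degree u + 1 = Fintype.card V)
    (huv : v ≠ u) : G.degree v = codegree G u v + 1 := by
  have h1 : G.neighborFinset v = insert u (G.neighborFinset u ∩ G.neighborFinset v) := by
    ext w
    by_cases hw : w = u
    · simp [hw, (adj_of_degree h huv).symm]
    · simp [hw, adj_of_degree h hw]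
  rw [← SimpleGraph.card_neighborFinset_eq_degree, h1, card_insert_of_notMem (by simp), codegree]

theorem nonempty_iso_of_two_dominating (hC5 : (SimpleGraph.cycleGraph 5).Free G) {n : ℕ}
    (hn : 6 ≤ n) (hcard : Fintype.card V = n) {u v : V} (huv : u ≠ v)
    (hu : G.degree u + 1 = n) (hv : G.degree v + 1 = n) :
    Nonempty (G ≃g splitGraph n 2) := by
  subst hcard
  refine nonempty_iso_splitGraph G rfl huv fun x y => ⟨fun h => ⟨h.ne, ?_⟩, ?_⟩
  · by_contra! hcon
    obtain ⟨⟨hxu, hxv⟩, hyu, hyv⟩ := hcon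
    -- An edge xy avoiding u and v closes the 5-cycle u x y v z through any fifth vertex z.
    obtain ⟨z, hz⟩ : ∃ z, z ∉ ({u, v, x, y} : Finset V) := by
      by_contra! hall
      have h4 : #(univ : Finset V) ≤ #({u, v, x, y} : Finset V) :=
        card_le_card fun z _ => hall z
      have := card_le_four (a := u) (b := v) (c := x) (d := y)
      rw [card_univ] at h4
      omega
    simp only [mem_insert, mem_singleton, not_or] at hz
    exact not_cycle_five hC5 (adj_of_degree hu hxu) h (adj_of_degree hv hyv).symm
      (adj_of_degree hv hz.2.1) (adj_of_degree hu hz.1).symm hyu.symm huv hxv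
      (Ne.symm hz.2.2.1) (Ne.symm hz.2.2.2)
  · rintro ⟨hxy, (rfl | rfl) | (rfl | rfl)⟩
    · exact adj_of_degree hu hxy.symm
    · exact adj_of_degree hv hxy.symm
    · exact (adj_of_degree hu hxy).symm
    · exact (adj_of_degree hv hxy).symm

/-- The bound for a graph with exactly one dominating vertex, by the test vector with entries
`10 n + 4` at that vertex and `9 d(v) + 1` elsewhere. -/
theorem qIndex_lt_of_unique_dominating (hC5 : (SimpleGraph.cycleGraph 5).Free G) {n : ℕ}
    (hn : 6 ≤ n) (hcard : Fintype.card V = n) {u : V} (hu : G.degree u + 1 = n)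
    (hd : ∀ v, v ≠ u → G.degree v + 2 ≤ n) : qIndex G < n + 2 - 4 / (n + 1) := by
  have : Nonempty V := ⟨u⟩
  have hn' : (6 : ℝ) ≤ n := by exact_mod_cast hn
  have hu' : G.degree u + 1 = Fintype.card V := hu.trans hcard.symm
  have hdu : (G.degree u : ℝ) = n - 1 := by
    have : (G.degree u : ℝ) + 1 = n := by exact_mod_cast hu
    linarith
  have hx : ∀ v ∈ G.neighborFinset u,
      (if v = u then 10 * (n : ℝ) + 4 else 9 * G.degree v + 1) = 9 * codegree G u v + 10 := by
    intro v hv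
    have hvu : v ≠ u := by rintro rfl; simp at hv
    rw [if_neg hvu, degree_eq_codegree_add_one hu' hvu]
    push_cast; ring
  -- The degree vector itself only yields the ratio n + 2 at u when G - u is a union of triangles.
  -- Raising the entry at u gains there, and the slack at the other vertices pays for it.
  refine qIndex_lt_of_test_vector G
    (fun v => if v = u then 10 * (n : ℝ) + 4 else 9 * G.degree v + 1) _ ?_ ?_
  · intro v
    split_ifs <;> positivity
  intro v
  by_cases hvu : v = u
  · subst hvu
    rw [sum_congr rfl hx, sum_add_distrib, ← mul_sum, sum_const,
      SimpleGraph.card_neighborFinset_eq_degree, nsmul_eq_mul, if_pos rfl, hdu]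
    have hF : (∑ w ∈ G.neighborFinset v, (codegree G v w : ℝ)) ≤ 2 * (n - 1) := by
      have h1 := sum_codegree_add_le hC5 v
      have h2 : #{w ∈ G.neighborFinset v | codegree G v w ≠ 0} ≤ G.degree v := by
        rw [← SimpleGraph.card_neighborFinset_eq_degree]
        exact card_filter_le _ _
      rw [← hdu]
      exact_mod_cast (show _ ≤ 2 * G.degree v by omega)
    have h4 : 4 / ((n : ℝ) + 1) * (10 * n + 4) ≤ 40 := by
      rw [div_mul_eq_mul_div, div_le_iff₀ (by positivity)]; linarith
    nlinarith
  -- 10/7 = 2 - 4/7 is the case n = 6.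
  · have hL : (n : ℝ) + 10 / 7 ≤ n + 2 - 4 / (n + 1) := by
      have : 4 / ((n : ℝ) + 1) ≤ 4 / 7 := by
        apply div_le_div_of_nonneg_left <;> linarith
      linarith
    generalize (n : ℝ) + 2 - 4 / (n + 1) = L at hL
    have hadj := adj_of_degree hu' hvu
    have h1 : G.neighborFinset v = insert u (G.neighborFinset u ∩ G.neighborFinset v) := by
      ext w
      by_cases hw : w = u
      · simp [hw, hadj.symm]
      · simp [hw, adj_of_degree hu' hw]
    have hsum : ∑ w ∈ G.neighborFinset v,
        (if w = u then 10 * (n : ℝ) + 4 else 9 * G.degree w + 1)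
        = 10 * n + 4 + (9 * (∑ w ∈ G.neighborFinset u ∩ G.neighborFinset v, codegree G u w : ℕ)
          + 10 * codegree G u v) := by
      rw [h1, sum_insert (by simp), if_pos rfl, ← h1,
        sum_congr rfl fun w hw => hx w (mem_inter.1 hw).1, sum_add_distrib, ← mul_sum, sum_const,
        nsmul_eq_mul, codegree]
      push_cast; ring
    have hbd : ∀ m, (∀ w ∈ G.neighborFinset u ∩ G.neighborFinset v, codegree G u w ≤ m) →
        ∑ w ∈ G.neighborFinset u ∩ G.neighborFinset v, codegree G u w ≤ codegree G u v * m := by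
      intro m hm
      rw [← smul_eq_mul]
      exact sum_le_card_nsmul _ _ _ hm
    have hloc : ∀ w ∈ G.neighborFinset u ∩ G.neighborFinset v, codegree G u v = 1 ∨
        codegree G u w = 1 ∨ (codegree G u v = 2 ∧ codegree G u w = 2) := by
      intro w hw
      simp only [mem_inter, SimpleGraph.mem_neighborFinset] at hw
      exact codegree_of_adj hC5 hadj hw.1 hw.2
    -- Needed when v is a leaf of a star in G - u, whose centre is not dominating; for the whole of
    -- G - u to be a star would give a second dominating vertex.
    have hub : ∀ w ∈ G.neighborFinset u ∩ G.neighborFinset v, codegree G u w ≤ n - 3 := by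
      intro w hw
      have hwu : w ≠ u := by rintro rfl; simp at hw
      have h2 := degree_eq_codegree_add_one hu' hwu
      have h3 := hd w hwu
      omega
    have hk3 : codegree G u v + 3 ≤ n := by
      have h2 := degree_eq_codegree_add_one hu' hvu
      have h3 := hd v hvu
      omega
    rw [hsum, if_neg hvu, degree_eq_codegree_add_one hu' hvu]
    generalize ∑ w ∈ G.neighborFinset u ∩ G.neighborFinset v, codegree G u w = F at *
    generalize codegree G u v = k at *
    have hk3' : (k : ℝ) + 3 ≤ n := by exact_mod_cast hk3
    rcases Nat.lt_or_ge k 3 with hk | hk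
    · interval_cases k
      · have : (F : ℝ) ≤ 0 := by exact_mod_cast (hbd _ hub).trans (by simp)
        norm_num
        linarith
      · have : (F : ℝ) ≤ n - 3 := by
          have h2 := hbd _ hub
          have : F + 3 ≤ n := by omega
          have : (F : ℝ) + 3 ≤ n := by exact_mod_cast this
          linarith
        norm_num
        linarith
      · have : (F : ℝ) ≤ 4 := by
          exact_mod_cast hbd 2 fun w hw => by rcases hloc w hw with h | h | h <;> omega
        norm_num
        linarith
    · have hF : (F : ℝ) ≤ k := by
        have h2 := hbd 1 fun w hw => by rcases hloc w hw with h | h | h <;> omega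
        rw [mul_one] at h2
        exact_mod_cast h2
      have hk' : (3 : ℝ) ≤ k := by exact_mod_cast hk
      have hm : ((n : ℝ) + 10 / 7) * (9 * (k + 1) + 1) ≤ L * (9 * (k + 1) + 1) := by gcongr
      have hm2 : (k : ℝ) * (k + 3) ≤ k * n := by gcongr
      push_cast
      linarith

end QIndex

theorem mainTheorem2 {V : Type*} [Fintype V] [DecidableEq V] (n : ℕ) (hn : 6 ≤ n)
    (G : SimpleGraph V) [DecidableRel G.Adj] (hcard : Fintype.card V = n)
    (hC5 : (SimpleGraph.cycleGraph 5).Free G)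
    (hne : ¬ Nonempty (G ≃g QIndex.splitGraph n 2)) :
    QIndex.qIndex G < QIndex.qIndex (QIndex.splitGraph n 2) := by
  refine lt_of_lt_of_le ?_ (QIndex.le_qIndex_splitGraph_two n hn)
  have hlt : ∀ v, G.degree v + 1 ≤ n := fun v => by
    have := G.degree_lt_card_verts v
    omega
  by_cases hdom : ∃ u, G.degree u + 1 = n
  · obtain ⟨u, hu⟩ := hdom
    refine QIndex.qIndex_lt_of_unique_dominating hC5 hn hcard hu fun v hvu => ?_
    by_contra hv
    have := hlt v
    exact hne (QIndex.nonempty_iso_of_two_dominating hC5 hn hcard hvu.symm hu (by omega))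
  · push Not at hdom
    refine QIndex.qIndex_lt_of_degree_le hC5 hn hcard ?_ fun v => ?_
    · have hn' : (6 : ℝ) ≤ n := by exact_mod_cast hn
      have : 4 / ((n : ℝ) + 1) ≤ 4 / 7 := by
        apply div_le_div_of_nonneg_left <;> linarith
      linarith
    · have := hlt v
      have := hdom v
      omega
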